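/- Let $d\ge 0$ and let $X_{i,s}$, $1\le i\le d$, $s\ge 1$, be $d$ data streams with no change in mean (hypothesis $H_0$): $X_{i,s}=\mu_i+\varepsilon_{i,s}$ for all $s\ge 1$, with constants $\mu_i\in\mathbb{R}$ and random errors $\varepsilon_{i,s}$. Let $m$ be the length of the historical period, let $h=h(m)\in\mathbb{N}$ be a window size with $h\to\infty$ and $h/m\to\beta\in(0,1]$ as $m\to\infty$, and put $S_i(x)=\sum_{s=1}^{\lfloor x\rfloor}\varepsilon_{i,s}$. Let $W_1,\dots,W_d$ be independent standard Brownian motions on $[0,\infty)$ and assume the functional central limit theorem on the errors: there are constants $\sigma_i>0$ such that, as $m\to\infty$, the processes $u\mapsto m^{-1/2}S_i(mu)$, $1\le i\le d$, converge jointly in distribution to $\sigma_iW_i$, $1\le i\le d$, in $D[0,\infty)^d$, where $D[0,\infty)$ carries the Skorokhod topology. Let $\hat\sigma_i=\hat\sigma_i(m)$ be estimators with $\hat\sigma_i\to\sigma_i$ in probability as $m\to\infty$ for every $i$. Define the local MOSUM statistics and the weights $$\mathcal{T}_i(m,k,h)=\frac{1}{\hat\sigma_i}\left|\sum_{s=m+k-h+1}^{m+k}X_{i,s}-\frac{h}{m}\sum_{s=1}^{m}X_{i,s}\right|,\qquad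 w(k,h)=\frac{1}{\sqrt h}\,\rho\!\left(\frac kh\right),$$ with a function $\rho:\mathbb{R}\to\mathbb{R}$, and, for a local threshold $c_{\mathrm{Local}}\in\mathbb{R}$, the global MOSUM statistic $$\mathcal{T}(m,k,h)=\begin{cases}\sqrt{\sum_{i=1}^d\mathcal{T}_i(m,k,h)^2}&\text{in the centralized case,}\\[2pt] \sqrt{\sum_{i=1}^d\mathcal{T}_i(m,k,h)^2\,\mathbf 1\{w(k,h)\mathcal{T}_i(m,k,h)>c_{\mathrm{Local}}\}}&\text{in the distributed case.}\end{cases}$$ Let $t>0$, let $\rho$ be continuous at $t$, let $k=\lfloor ht\rfloor$, and put $$Z_i(t)=\left|W_i\!\left(\tfrac1\beta+t\right)-W_i\!\left(\tfrac1\beta+t-1\right)-\beta W_i\!\left(\tfrac1\beta\right)\right|.$$ Then, as $m\to\infty$, $w(k,h)\,\mathcal{T}(m,k,h)$ converges in distribution to $$\rho(t)\sqrt{\sum_{i=1}^dZ_i(t)^2}\ \text{ in the centralized case,}\qquad \rho(t)\sqrt{\sum_{i=1}^dZ_i(t)^2\,\mathbf 1\{\rho(t)Z_i(t)>c_{\mathrm{Local}}\}}\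 \text{ in the distributed case.}$$ -/

import Mathlib

open Filter Topology MeasureTheory ProbabilityTheory
open scoped NNReal

noncomputable section

namespace Mosum

/-! ### Weak convergence in the Skorokhod space `D[0, ∞)` -/

/-- A path on `[0, ∞)` that is right-continuous with left limits. -/
def IsCadlag (x : ℝ≥0 → ℝ) : Prop :=
  ∀ t, ContinuousWithinAt x (Set.Ici t) t ∧ ∃ l, Tendsto x (𝓝[<] t) (𝓝 l)

/-- The set of càdlàg paths on `[0, ∞)`. -/
def SkorokhodSpace : Type := {x : ℝ≥0 → ℝ // IsCadlag x}

/-- The σ-algebra generated by the evaluations; it is the Borel σ-algebra of the Skorokhod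
topology. -/
instance : MeasurableSpace SkorokhodSpace :=
  MeasurableSpace.comap (fun x : SkorokhodSpace => x.1) MeasurableSpace.pi

/-- Convergence of a sequence in the (metrizable) Skorokhod `J₁` topology of `D[0, ∞)`: there are
increasing bijections `lam n` of `[0, ∞)` with `lam n → id` uniformly and `x n ∘ lam n → y`
uniformly on bounded intervals. -/
def J1Tendsto (x : ℕ → SkorokhodSpace) (y : SkorokhodSpace) : Prop :=
  ∃ lam : ℕ → (ℝ≥0 ≃o ℝ≥0),
    TendstoUniformly (fun n s => lam n s) id atTop ∧
    ∀ T : ℝ≥0, TendstoUniformlyOn (fun n s => (x n).1 (lam n s)) y.1 atTop (Set.Iic T)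

/-- Continuity of a functional on a product of copies of `D[0, ∞)`; the `J₁` topology is
metrizable, so that sequential continuity is continuity. -/
def J1Continuous {ι : Type*} (F : (ι → SkorokhodSpace) → ℝ) : Prop :=
  ∀ (x : ℕ → ι → SkorokhodSpace) (y : ι → SkorokhodSpace),
    (∀ i, J1Tendsto (fun n => x n i) (y i)) → Tendsto (fun n => F (x n)) atTop (𝓝 (F y))

theorem isCadlag_of_continuous {x : ℝ≥0 → ℝ} (hx : Continuous x) : IsCadlag x :=
  fun t => ⟨hx.continuousWithinAt, x t, hx.continuousAt.tendsto.mono_left nhdsWithin_le_nhds⟩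

open scoped Classical in
/-- A path as an element of `D[0, ∞)`. It is used only for processes whose paths are almost surely
càdlàg; the value at other paths plays no role. -/
def toSkorokhod (x : ℝ≥0 → ℝ) : SkorokhodSpace :=
  if hx : IsCadlag x then ⟨x, hx⟩ else ⟨fun _ => 0, isCadlag_of_continuous continuous_const⟩

/-- Joint convergence in distribution, in a product of copies of `D[0, ∞)`, of the processes
`(X n i)_i` under `P` to the processes `(Y i)_i` under `P'`: the expectations of all bounded
continuous functionals converge. -/
def TendstoInDistributionD {ι Ω Ω' : Type*} [MeasurableSpace Ω] [MeasurableSpace Ω']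
    (X : ℕ → ι → ℝ≥0 → Ω → ℝ) (Y : ι → ℝ≥0 → Ω' → ℝ) (P : Measure Ω) (P' : Measure Ω') : Prop :=
  ∀ F : (ι → SkorokhodSpace) → ℝ, Measurable F → (∃ C, ∀ x, |F x| ≤ C) → J1Continuous F →
    Tendsto (fun n => ∫ ω, F (fun i => toSkorokhod (fun u => X n i u ω)) ∂P) atTop
      (𝓝 (∫ ω, F (fun i => toSkorokhod (fun u => Y i u ω)) ∂P'))

/-! ### Partial sums of the errors -/

/-- `S_i(x) = ∑_{1 ≤ s ≤ ⌊x⌋} ε_{i,s}`. -/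
def partialSum {ι Ω : Type*} (ε : ι → ℕ → Ω → ℝ) (i : ι) (x : ℝ) (ω : Ω) : ℝ :=
  ∑ s ∈ Finset.Icc 1 ⌊x⌋₊, ε i s ω

/-- The process `u ↦ S_i(m u) / √m`. -/
def scaledSum {ι Ω : Type*} (ε : ι → ℕ → Ω → ℝ) (m : ℕ) (i : ι) (u : ℝ≥0) (ω : Ω) : ℝ :=
  1 / √(m : ℝ) * partialSum ε i (m * u) ω

/-- The paths `u ↦ S_i(m u) / √m` are càdlàg. -/
theorem isCadlag_scaledSum {ι Ω : Type*} (ε : ι → ℕ → Ω → ℝ) (m : ℕ) (i : ι) (ω : Ω) :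
    IsCadlag (fun u => scaledSum ε m i u ω) := by
  set f : ℕ → ℝ := fun n => 1 / √(m : ℝ) * ∑ s ∈ Finset.Icc 1 n, ε i s ω with hf
  have key : (fun u => scaledSum ε m i u ω) = fun u : ℝ≥0 => f ⌊(m : ℝ≥0) * u⌋₊ := by
    funext u
    simp only [scaledSum, partialSum, hf]
    have : ⌊((m : ℝ) * (u : ℝ))⌋₊ = ⌊(m : ℝ≥0) * u⌋₊ := by
      apply le_antisymm
      · refine Nat.le_floor ?_
        have := Nat.floor_le (show (0 : ℝ) ≤ (m : ℝ) * (u : ℝ) by positivity)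
        exact_mod_cast this
      · refine Nat.le_floor ?_
        have := Nat.floor_le (show 0 ≤ (m : ℝ≥0) * u by positivity)
        exact_mod_cast this
    rw [this]
  rw [key]
  intro t
  have hmono : Monotone (fun u : ℝ≥0 => ⌊(m : ℝ≥0) * u⌋₊) :=
    fun a b hab => Nat.floor_mono (by gcongr)
  constructor
  · have hc : Continuous (fun u : ℝ≥0 => (m : ℝ≥0) * u) := by fun_prop
    have h1 : ∀ᶠ u in 𝓝[≥] t, (m : ℝ≥0) * u < (⌊(m : ℝ≥0) * t⌋₊ : ℝ≥0) + 1 :=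
      nhdsWithin_le_nhds
        (hc.continuousAt.eventually_lt continuousAt_const (Nat.lt_floor_add_one _))
    have h2 : (fun u : ℝ≥0 => f ⌊(m : ℝ≥0) * u⌋₊) =ᶠ[𝓝[≥] t]
        fun _ => f ⌊(m : ℝ≥0) * t⌋₊ := by
      filter_upwards [h1, self_mem_nhdsWithin] with u hu hut
      congr 1
      apply le_antisymm
      · have : ⌊(m : ℝ≥0) * u⌋₊ < ⌊(m : ℝ≥0) * t⌋₊ + 1 :=
          (Nat.floor_lt (by positivity)).2 (by push_cast; exact hu)
        omega
      · exact hmono hut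
    exact continuousWithinAt_const.congr_of_eventuallyEq h2 rfl
  · rcases eq_or_ne t 0 with rfl | ht
    · exact ⟨0, by simp⟩
    have hbdd : BddAbove ((fun u : ℝ≥0 => ⌊(m : ℝ≥0) * u⌋₊) '' Set.Iio t) :=
      ⟨⌊(m : ℝ≥0) * t⌋₊, by rintro _ ⟨u, hu, rfl⟩; exact hmono (le_of_lt hu)⟩
    have hne : (Set.Iio t).Nonempty := ⟨0, pos_iff_ne_zero.2 ht⟩
    have hlim : Tendsto (fun u : ℝ≥0 => ⌊(m : ℝ≥0) * u⌋₊) (𝓝[<] t)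
        (𝓝 (sSup ((fun u : ℝ≥0 => ⌊(m : ℝ≥0) * u⌋₊) '' Set.Iio t))) :=
      hmono.tendsto_nhdsLT t
    exact ⟨_, (continuous_of_discreteTopology (f := f)).continuousAt.tendsto.comp hlim⟩

/-- Functional central limit theorem for the errors: the processes `S_i(m ·) / √m`, `i : ι`,
converge jointly in distribution to `σ_i W_i(·)`, `i : ι`. -/
def FCLT {ι Ω Ω' : Type*} [MeasurableSpace Ω] [MeasurableSpace Ω']
    (ε : ι → ℕ → Ω → ℝ) (σ : ι → ℝ) (W : ι → ℝ≥0 → Ω' → ℝ)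
    (P : Measure Ω) (P' : Measure Ω') : Prop :=
  TendstoInDistributionD (scaledSum ε) (fun i u ω => σ i * W i u ω) P P'

/-! ### The asymptotic regime and the null hypothesis -/

/-- `h = h(m) → ∞` and `h / m → β ∈ (0, 1]` as `m → ∞`. -/
structure AsymptoticRegime (h : ℕ → ℕ) (β : ℝ) : Prop where
  window_tendsto : Tendsto h atTop atTop
  ratio_tendsto : Tendsto (fun m : ℕ => (h m : ℝ) / m) atTop (𝓝 β)
  pos : 0 < β
  le_one : β ≤ 1

/-- The null hypothesis (no change ever occurs): `X_{i,s} = μ_i + ε_{i,s}` for every `s ≥ 1`. -/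
def NullModel {ι Ω : Type*} (X : ι → ℕ → Ω → ℝ) (μ : ι → ℝ) (ε : ι → ℕ → Ω → ℝ) : Prop :=
  ∀ i s ω, 1 ≤ s → X i s ω = μ i + ε i s ω

/-! ### The MOSUM statistics -/

/-- The local MOSUM statistic `𝒯_i(m, k, h)` computed from the data `X` and the estimators `σhat` of
the long-run standard deviations. -/
def localStat {ι Ω : Type*} (X : ι → ℕ → Ω → ℝ) (σhat : ι → Ω → ℝ) (m k h : ℕ) (i : ι) (ω : Ω) :
    ℝ :=
  1 / σhat i ω *
    |∑ s ∈ Finset.Icc (m + k - h + 1) (m + k), X i s ω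
      - (h : ℝ) / m * ∑ s ∈ Finset.Icc 1 m, X i s ω|

/-- The weight `w(k, h) = h^{-1/2} ρ(k / h)`. -/
def weight (ρ : ℝ → ℝ) (k h : ℕ) : ℝ := 1 / √(h : ℝ) * ρ ((k : ℝ) / h)

/-- The global MOSUM statistic `𝒯(m, k, h)` in the centralized case. -/
def centralizedStat {ι Ω : Type*} [Fintype ι] (X : ι → ℕ → Ω → ℝ) (σhat : ι → Ω → ℝ)
    (m k h : ℕ) (ω : Ω) : ℝ :=
  √(∑ i, localStat X σhat m k h i ω ^ 2)

open scoped Classical in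
/-- The global MOSUM statistic `𝒯(m, k, h)` in the distributed case: only the sensors with
`w(k, h) 𝒯_i(m, k, h) > c` transmit. -/
def distributedStat {ι Ω : Type*} [Fintype ι] (ρ : ℝ → ℝ) (c : ℝ) (X : ι → ℕ → Ω → ℝ)
    (σhat : ι → Ω → ℝ) (m k h : ℕ) (ω : Ω) : ℝ :=
  √(∑ i, localStat X σhat m k h i ω ^ 2 *
    (if weight ρ k h * localStat X σhat m k h i ω > c then 1 else 0))

/-! ### The limits -/

/-- `Z_i(t) = |W_i(1/β + t) - W_i(1/β + t - 1) - β W_i(1/β)|`; all the times are non-negative for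
`0 < β ≤ 1` and `t > 0`. -/
def limitZ {ι Ω' : Type*} (W : ι → ℝ≥0 → Ω' → ℝ) (β t : ℝ) (i : ι) (ω : Ω') : ℝ :=
  |W i (1 / β + t).toNNReal ω - W i (1 / β + t - 1).toNNReal ω - β * W i (1 / β).toNNReal ω|

/-- The limit in the centralized case. -/
def centralizedLimit {ι Ω' : Type*} [Fintype ι] (ρ : ℝ → ℝ) (W : ι → ℝ≥0 → Ω' → ℝ) (β t : ℝ)
    (ω : Ω') : ℝ :=
  ρ t * √(∑ i, limitZ W β t i ω ^ 2)

open scoped Classical in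
/-- The limit in the distributed case. -/
def distributedLimit {ι Ω' : Type*} [Fintype ι] (ρ : ℝ → ℝ) (c : ℝ) (W : ι → ℝ≥0 → Ω' → ℝ)
    (β t : ℝ) (ω : Ω') : ℝ :=
  ρ t * √(∑ i, limitZ W β t i ω ^ 2 * (if ρ t * limitZ W β t i ω > c then 1 else 0))

end Mosum

end

noncomputable section

namespace Mosum

/-! ### Continuous envelopes of càdlàg paths -/

/-! Under the null hypothesis the means cancel, so each local statistic is a function of the scaled
partial sums at the three times `(m+k)/m`, `(m+k-h)/m` and `1`, of `h/m`, and of the estimator.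
These times converge to `1+tβ`, `1+tβ-β` and `1`. The limit theorem thus follows from joint
convergence of the partial sums at these moving times, Slutsky's lemma, Brownian scaling and the
continuous mapping theorem.

Evaluation at a time is not a continuous functional on Skorokhod space, and here the times also
move. A path near `T` is therefore squeezed between `upperEnvelope` of the path and the negative of
that of its negation; both are continuous in the path. The envelope is the logarithm of a supremum
of `exp x` times a cutoff: exponentiating makes the weighted values nonnegative, so the zeros
outside the window never win the supremum, even for negative paths. The gap between the envelopes
tends to zero on continuous limit paths as the window shrinks. This gives
`TendstoInDistributionD.tendstoInDistribution_eval`.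

In the distributed case the indicators are discontinuous only where `ρ(t) Z_i(t) = c`. If `ρ(t) ≠ 0`
this is a null event, because the Brownian contrast is a Gaussian variable of positive variance
(`ae_contrast_ne`). If `ρ(t) = 0` the outer factor forces continuity, whatever the indicators do. -/

theorem IsCadlag.exists_bound {x : ℝ≥0 → ℝ} (hx : IsCadlag x) (R : ℝ≥0) :
    ∃ C, ∀ s ≤ R, |x s| ≤ C := by
  have hK : IsCompact (Set.Icc 0 R) := isCompact_Icc
  -- One-sided limits bound the path near each point; compactness of `[0, R]` glues the local
  -- bounds.
  obtain ⟨C, hC⟩ := hK.induction_on (p := fun S => ∃ C, ∀ s ∈ S, |x s| ≤ C) ⟨0, by simp⟩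
    (fun S S' hS ⟨C, hC⟩ => ⟨C, fun s hs => hC s (hS hs)⟩)
    (fun S S' ⟨C, hC⟩ ⟨C', hC'⟩ => ⟨max C C', fun s hs => by
      rcases hs with hs | hs
      · exact (hC s hs).trans (le_max_left _ _)
      · exact (hC' s hs).trans (le_max_right _ _)⟩)
    (fun s _ => by
      obtain ⟨hr, l, hl⟩ := hx s
      have h1 : ∀ᶠ u in 𝓝[≥] s, |x u| < |x s| + 1 :=
        hr.tendsto.abs.eventually_lt_const (by linarith)
      have h2 : ∀ᶠ u in 𝓝[<] s, |x u| < |l| + 1 :=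
        hl.abs.eventually_lt_const (by linarith)
      have h3 : ∀ᶠ u in 𝓝 s, |x u| ≤ max (|x s| + 1) (|l| + 1) := by
        rw [← nhdsLT_sup_nhdsGE, eventually_sup]
        exact ⟨h2.mono fun u hu => hu.le.trans (le_max_right _ _),
          h1.mono fun u hu => hu.le.trans (le_max_left _ _)⟩
      exact ⟨_, mem_nhdsWithin_of_mem_nhds h3, _, fun u hu => hu⟩)
  exact ⟨C, fun s hs => hC s ⟨zero_le, hs⟩⟩

theorem IsCadlag.neg {x : ℝ≥0 → ℝ} (hx : IsCadlag x) : IsCadlag (-x) := fun t =>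
  ⟨(hx t).1.neg, let ⟨l, hl⟩ := (hx t).2; ⟨-l, hl.neg⟩⟩

/-- The tent function that is `1` within distance `δ` of `T` and `0` beyond distance `2 δ`. -/
def plateau (T : ℝ≥0) (δ : ℝ) (s : ℝ≥0) : ℝ := max 0 (min 1 (2 - dist s T / δ))

theorem plateau_nonneg (T : ℝ≥0) (δ : ℝ) (s : ℝ≥0) : 0 ≤ plateau T δ s := le_max_left _ _

theorem plateau_le_one (T : ℝ≥0) (δ : ℝ) (s : ℝ≥0) : plateau T δ s ≤ 1 :=
  max_le zero_le_one (min_le_left _ _)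

theorem plateau_eq_one {T s : ℝ≥0} {δ : ℝ} (hδ : 0 < δ) (h : dist s T ≤ δ) :
    plateau T δ s = 1 := by
  have : dist s T / δ ≤ 1 := (div_le_one hδ).2 h
  rw [plateau, min_eq_left (by linarith), max_eq_right zero_le_one]

theorem plateau_eq_zero {T s : ℝ≥0} {δ : ℝ} (hδ : 0 < δ) (h : 2 * δ ≤ dist s T) :
    plateau T δ s = 0 := by
  have : 2 ≤ dist s T / δ := (le_div_iff₀ hδ).2 h
  rw [plateau, max_eq_left ((min_le_right _ _).trans (by linarith))]

theorem plateau_eq_zero_of_le {T s : ℝ≥0} {δ : ℝ} (hδ : 0 < δ) (h : (T : ℝ) + 2 * δ ≤ s) :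
    plateau T δ s = 0 := by
  refine plateau_eq_zero hδ ?_
  rw [NNReal.dist_eq]
  exact le_trans (by linarith) (le_abs_self _)

theorem abs_plateau_sub_le (T : ℝ≥0) {δ : ℝ} (hδ : 0 < δ) (s u : ℝ≥0) :
    |plateau T δ s - plateau T δ u| ≤ dist s u / δ := by
  have h1 : |plateau T δ s - plateau T δ u| ≤ |(2 - dist s T / δ) - (2 - dist u T / δ)| := by
    rw [plateau, plateau, max_comm 0, max_comm 0, min_comm 1, min_comm 1]
    exact (abs_max_sub_max_le_abs _ _ _).trans (abs_inf_sub_inf_le_abs _ _ _)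
  refine h1.trans ?_
  have h2 : (2 - dist s T / δ) - (2 - dist u T / δ) = (dist u T - dist s T) / δ := by ring
  rw [h2, abs_div, abs_of_pos hδ]
  gcongr
  rw [dist_comm s u]
  exact abs_dist_sub_le u s T

theorem continuous_plateau (T : ℝ≥0) (δ : ℝ) : Continuous (plateau T δ) := by
  unfold plateau
  fun_prop

/-- The supremum of a path weighted by a tent function, on the exponential scale. -/
def expEnvelope (T : ℝ≥0) (δ : ℝ) (x : ℝ≥0 → ℝ) : ℝ :=
  ⨆ s, plateau T δ s * Real.exp (x s)

/-- An upper bound of a path near `T` that depends continuously on the path. -/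
def upperEnvelope (T : ℝ≥0) (δ : ℝ) (x : ℝ≥0 → ℝ) : ℝ := Real.log (expEnvelope T δ x)

theorem IsCadlag.exists_exp_bound {x : ℝ≥0 → ℝ} (hx : IsCadlag x) (R : ℝ≥0) :
    ∃ M, 0 < M ∧ ∀ s ≤ R, Real.exp (x s) ≤ M := by
  obtain ⟨C, hC⟩ := hx.exists_bound R
  exact ⟨Real.exp C, Real.exp_pos _, fun s hs =>
    Real.exp_le_exp.2 ((le_abs_self _).trans (hC s hs))⟩

theorem bddAbove_expEnvelope {x : ℝ≥0 → ℝ} (hx : IsCadlag x) (T : ℝ≥0) {δ : ℝ} (hδ : 0 < δ) :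
    BddAbove (Set.range fun s => plateau T δ s * Real.exp (x s)) := by
  obtain ⟨M, hM0, hM⟩ := hx.exists_exp_bound (T + 2 * δ.toNNReal)
  refine ⟨M, ?_⟩
  rintro _ ⟨s, rfl⟩
  rcases le_total s (T + 2 * δ.toNNReal) with hs | hs
  · exact (mul_le_of_le_one_left (Real.exp_pos _).le (plateau_le_one T δ s)).trans (hM s hs)
  · have : (T : ℝ) + 2 * δ ≤ s := by
      have h := NNReal.coe_le_coe.2 hs
      push_cast at h
      rwa [Real.coe_toNNReal _ hδ.le] at h
    simp only [plateau_eq_zero_of_le hδ this, zero_mul]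
    exact hM0.le

theorem exp_le_expEnvelope {x : ℝ≥0 → ℝ} (hx : IsCadlag x) {T s : ℝ≥0} {δ : ℝ} (hδ : 0 < δ)
    (hs : dist s T ≤ δ) : Real.exp (x s) ≤ expEnvelope T δ x := by
  have := le_ciSup (bddAbove_expEnvelope hx T hδ) s
  rwa [plateau_eq_one hδ hs, one_mul] at this

theorem expEnvelope_pos {x : ℝ≥0 → ℝ} (hx : IsCadlag x) (T : ℝ≥0) {δ : ℝ} (hδ : 0 < δ) :
    0 < expEnvelope T δ x :=
  (Real.exp_pos _).trans_le (exp_le_expEnvelope hx (s := T) hδ (by simpa using hδ.le))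

theorem le_upperEnvelope {x : ℝ≥0 → ℝ} (hx : IsCadlag x) {T s : ℝ≥0} {δ : ℝ} (hδ : 0 < δ)
    (hs : dist s T ≤ δ) : x s ≤ upperEnvelope T δ x :=
  (Real.le_log_iff_exp_le (expEnvelope_pos hx T hδ)).2 (exp_le_expEnvelope hx hδ hs)

theorem upperEnvelope_le {x : ℝ≥0 → ℝ} (hx : IsCadlag x) {T : ℝ≥0} {δ B : ℝ} (hδ : 0 < δ)
    (hB : ∀ s, dist s T < 2 * δ → x s ≤ B) : upperEnvelope T δ x ≤ B := by
  refine (Real.log_le_iff_le_exp (expEnvelope_pos hx T hδ)).2 (ciSup_le fun s => ?_)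
  rcases lt_or_ge (dist s T) (2 * δ) with hs | hs
  · exact (mul_le_of_le_one_left (Real.exp_pos _).le (plateau_le_one T δ s)).trans
      (Real.exp_le_exp.2 (hB s hs))
  · rw [plateau_eq_zero hδ hs, zero_mul]
    exact (Real.exp_pos _).le

theorem tendsto_upperEnvelope_of_continuous {x : ℝ≥0 → ℝ} (hx : Continuous x) (T : ℝ≥0)
    {δ : ℕ → ℝ} (hδ : ∀ n, 0 < δ n) (hδ0 : Tendsto δ atTop (𝓝 0)) :
    Tendsto (fun n => upperEnvelope T (δ n) x) atTop (𝓝 (x T)) := by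
  have hc := isCadlag_of_continuous hx
  rw [Metric.tendsto_atTop']
  intro r hr
  obtain ⟨η, hη, hη'⟩ := Metric.continuous_iff.1 hx T (r / 2) (by positivity)
  obtain ⟨N, hN⟩ := eventually_atTop.1 (hδ0.eventually_lt_const (show 0 < η / 2 by positivity))
  refine ⟨N, fun n hn => ?_⟩
  have h1 := le_upperEnvelope hc (s := T) (T := T) (hδ n) (by simpa using (hδ n).le)
  have h2 : upperEnvelope T (δ n) x ≤ x T + r / 2 := upperEnvelope_le hc (hδ n) fun s hs => by
    have h3 := hη' s (hs.trans (by linarith [hN n hn.le]))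
    rw [Real.dist_eq] at h3
    linarith [(abs_lt.1 h3).2]
  rw [Real.dist_eq, abs_of_nonneg (by linarith)]
  linarith

/-- By right-continuity, a value at `s` is nearly attained on an open interval to the right of `s`,
which meets the dense sequence. The countable supremum makes the envelope measurable for the
σ-algebra of evaluations. -/
theorem expEnvelope_eq_iSup_denseSeq {x : ℝ≥0 → ℝ} (hx : IsCadlag x) (T : ℝ≥0) {δ : ℝ}
    (hδ : 0 < δ) : expEnvelope T δ x = ⨆ n : ℕ, plateau T δ (TopologicalSpace.denseSeq ℝ≥0 n) *
      Real.exp (x (TopologicalSpace.denseSeq ℝ≥0 n)) := by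
  set f : ℝ≥0 → ℝ := fun s => plateau T δ s * Real.exp (x s) with hf
  have hb : BddAbove (Set.range f) := bddAbove_expEnvelope hx T hδ
  have hb' : BddAbove (Set.range fun n => f (TopologicalSpace.denseSeq ℝ≥0 n)) :=
    hb.mono (by rintro _ ⟨n, rfl⟩; exact ⟨_, rfl⟩)
  refine le_antisymm (ciSup_le fun s => ?_) (ciSup_le fun n => le_ciSup hb _)
  refine le_of_forall_lt fun a ha => ?_
  have hfc : ContinuousWithinAt f (Set.Ici s) s :=
    (continuous_plateau T δ).continuousWithinAt.mul (hx s).1.rexp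
  have h1 : ∀ᶠ u in 𝓝[>] s, a < f u :=
    (hfc.eventually_const_lt ha).filter_mono (nhdsWithin_mono _ Set.Ioi_subset_Ici_self)
  obtain ⟨u, hu, hu'⟩ := (mem_nhdsGT_iff_exists_Ioo_subset).1 h1
  obtain ⟨n, hn⟩ := (TopologicalSpace.denseRange_denseSeq ℝ≥0).exists_mem_open isOpen_Ioo
    (Set.nonempty_Ioo.2 hu)
  exact (hu' hn).trans_le (le_ciSup hb' n)

theorem aemeasurable_upperEnvelope {Ω : Type*} [MeasurableSpace Ω] {μ : Measure Ω}
    {ξ : Ω → ℝ≥0 → ℝ} (hξ : ∀ ω, IsCadlag (ξ ω)) (hm : ∀ u, AEMeasurable (fun ω => ξ ω u) μ)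
    (T : ℝ≥0) {δ : ℝ} (hδ : 0 < δ) : AEMeasurable (fun ω => upperEnvelope T δ (ξ ω)) μ := by
  simp only [upperEnvelope, expEnvelope_eq_iSup_denseSeq (hξ _) T hδ]
  refine Real.measurable_log.comp_aemeasurable (AEMeasurable.iSup fun n => ?_)
  exact (Real.measurable_exp.comp_aemeasurable (hm _)).const_mul _

theorem measurable_upperEnvelope {Ω : Type*} [MeasurableSpace Ω]
    {ξ : Ω → ℝ≥0 → ℝ} (hξ : ∀ ω, IsCadlag (ξ ω)) (hm : ∀ u, Measurable (fun ω => ξ ω u))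
    (T : ℝ≥0) {δ : ℝ} (hδ : 0 < δ) : Measurable (fun ω => upperEnvelope T δ (ξ ω)) := by
  simp only [upperEnvelope, expEnvelope_eq_iSup_denseSeq (hξ _) T hδ]
  refine Real.measurable_log.comp (Measurable.iSup fun n => ?_)
  exact (Real.measurable_exp.comp (hm _)).const_mul _

theorem abs_ciSup_sub_ciSup_le {α : Type*} [Nonempty α] {f g : α → ℝ} {r : ℝ}
    (hf : BddAbove (Set.range f)) (hg : BddAbove (Set.range g)) (h : ∀ a, |f a - g a| ≤ r) :
    |(⨆ a, f a) - ⨆ a, g a| ≤ r := by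
  rw [abs_sub_le_iff, sub_le_iff_le_add, sub_le_iff_le_add]
  constructor
  · refine ciSup_le fun a => ?_
    linarith [(abs_sub_le_iff.1 (h a)).1, le_ciSup hg a]
  · refine ciSup_le fun a => ?_
    linarith [(abs_sub_le_iff.1 (h a)).2, le_ciSup hf a]

theorem abs_mul_exp_sub_le {p q a b : ℝ} (hp : |p| ≤ 1) (hab : |a - b| ≤ 1) :
    |p * Real.exp a - q * Real.exp b| ≤ Real.exp b * (2 * |a - b| + |p - q|) := by
  have h1 : p * Real.exp a - q * Real.exp b =
      Real.exp b * (p * (Real.exp (a - b) - 1) + (p - q)) := by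
    rw [Real.exp_sub]
    field_simp
    ring
  rw [h1, abs_mul, abs_of_pos (Real.exp_pos b)]
  gcongr
  refine (abs_add_le _ _).trans ?_
  gcongr
  rw [abs_mul]
  calc |p| * |Real.exp (a - b) - 1| ≤ 1 * |Real.exp (a - b) - 1| := by gcongr
    _ ≤ 2 * |a - b| := by rw [one_mul]; exact Real.abs_exp_sub_one_le hab

/-- A supremum over all times is invariant under the bijective time changes. After reparametrization
the paths are uniformly close on `[0, R]`, the Lipschitz cutoff absorbs the time shift, and past `R`
both cutoffs vanish. -/
theorem tendsto_expEnvelope {x : ℕ → ℝ≥0 → ℝ} {y : ℝ≥0 → ℝ} (hx : ∀ n, IsCadlag (x n))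
    (hy : IsCadlag y) {lam : ℕ → (ℝ≥0 ≃o ℝ≥0)}
    (hlam : TendstoUniformly (fun n s => lam n s) id atTop)
    (hxy : ∀ R : ℝ≥0, TendstoUniformlyOn (fun n s => x n (lam n s)) y atTop (Set.Iic R))
    (T : ℝ≥0) {δ : ℝ} (hδ : 0 < δ) :
    Tendsto (fun n => expEnvelope T δ (x n)) atTop (𝓝 (expEnvelope T δ y)) := by
  -- The margin `1` dominates the time shift `η ≤ 1`, so that `s ≥ R` also puts `lam n s` outside
  -- the support of the cutoff.
  set R : ℝ≥0 := T + 2 * δ.toNNReal + 1 with hR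
  have hRc : (R : ℝ) = T + 2 * δ + 1 := by simp [hR, Real.coe_toNNReal _ hδ.le]
  obtain ⟨M, hM0, hM⟩ := hy.exists_exp_bound R
  rw [Metric.tendsto_atTop']
  intro r hr
  -- The bound `1` permits the linear estimate of `exp`; the other one makes the total error, `2η`
  -- from the path and `η/δ` from the cutoff, both times `M`, at most `r/2`.
  set η : ℝ := min 1 (r / (2 * M * (2 + 1 / δ))) with hη
  have hη0 : 0 < η := lt_min one_pos (by positivity)
  have hη1 : η ≤ 1 := min_le_left _ _
  have hηr : M * (2 * η + η / δ) ≤ r / 2 := by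
    have : η ≤ r / (2 * M * (2 + 1 / δ)) := min_le_right _ _
    rw [le_div_iff₀ (by positivity)] at this
    calc M * (2 * η + η / δ) = η * (2 * M * (2 + 1 / δ)) / 2 := by ring
      _ ≤ r / 2 := by gcongr
  obtain ⟨N, hN⟩ := eventually_atTop.1 ((Metric.tendstoUniformly_iff.1 hlam η hη0).and
    (Metric.tendstoUniformlyOn_iff.1 (hxy R) η hη0))
  refine ⟨N, fun n hn => ?_⟩
  obtain ⟨h1, h2⟩ := hN n hn.le
  have hsup : expEnvelope T δ (x n) =
      ⨆ s, plateau T δ (lam n s) * Real.exp (x n (lam n s)) :=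
    ((lam n).toEquiv.iSup_comp (g := fun s => plateau T δ s * Real.exp (x n s))).symm
  have hb : BddAbove (Set.range fun s => plateau T δ (lam n s) * Real.exp (x n (lam n s))) :=
    (bddAbove_expEnvelope (hx n) T hδ).mono (by rintro _ ⟨s, rfl⟩; exact ⟨lam n s, rfl⟩)
  rw [Real.dist_eq, hsup]
  refine (abs_ciSup_sub_ciSup_le hb (bddAbove_expEnvelope hy T hδ) (r := r / 2)
    fun s => ?_).trans_lt (by linarith)
  have h1s : dist s (lam n s) < η := h1 s
  rcases le_total s R with hs | hs
  · have h2s : |x n (lam n s) - y s| < η := by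
      rw [← Real.dist_eq, dist_comm]
      exact h2 s hs
    refine (abs_mul_exp_sub_le ?_ (h2s.le.trans hη1)).trans (le_trans ?_ hηr)
    · rw [abs_of_nonneg (plateau_nonneg _ _ _)]
      exact plateau_le_one _ _ _
    · have h3 := abs_plateau_sub_le T hδ (lam n s) s
      rw [dist_comm] at h3
      have h4 : dist s (lam n s) / δ ≤ η / δ := by gcongr
      have h5 := hM s hs
      gcongr
      exact h3.trans h4
  · have hs' : (R : ℝ) ≤ s := NNReal.coe_le_coe.2 hs
    have h6 : (s : ℝ) - lam n s < η := (le_abs_self _).trans_lt (by rwa [← NNReal.dist_eq])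
    rw [plateau_eq_zero_of_le hδ (s := s) (by linarith),
      plateau_eq_zero_of_le hδ (s := lam n s) (by linarith)]
    simp only [zero_mul, sub_self, abs_zero]
    positivity

theorem tendsto_upperEnvelope {x : ℕ → SkorokhodSpace} {y : SkorokhodSpace}
    (hxy : J1Tendsto x y) (T : ℝ≥0) {δ : ℝ} (hδ : 0 < δ) :
    Tendsto (fun n => upperEnvelope T δ (x n).1) atTop (𝓝 (upperEnvelope T δ y.1)) := by
  obtain ⟨lam, h1, h2⟩ := hxy
  exact (tendsto_expEnvelope (fun n => (x n).2) y.2 h1 h2 T hδ).log (expEnvelope_pos y.2 T hδ).ne'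

theorem tendsto_upperEnvelope_neg {x : ℕ → SkorokhodSpace} {y : SkorokhodSpace}
    (hxy : J1Tendsto x y) (T : ℝ≥0) {δ : ℝ} (hδ : 0 < δ) :
    Tendsto (fun n => upperEnvelope T δ (-(x n).1)) atTop (𝓝 (upperEnvelope T δ (-y.1))) := by
  obtain ⟨lam, h1, h2⟩ := hxy
  refine (tendsto_expEnvelope (fun n => (x n).2.neg) y.2.neg h1 (fun R => ?_) T hδ).log
    (expEnvelope_pos y.2.neg T hδ).ne'
  exact (h2 R).neg

/-! ### Convergence at finitely many converging times -/

section Eval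

variable {ι κ : Type*}

/-- The upper envelopes of finitely many paths near finitely many times. -/
def envelopeVector (T : κ → ℝ≥0) (δ : ℝ) (x : ι → SkorokhodSpace) (p : ι × κ) : ℝ :=
  upperEnvelope (T p.2) δ (x p.1).1

/-- The sum of the differences of the upper and lower envelopes. -/
def envelopeGap [Fintype ι] [Fintype κ] (T : κ → ℝ≥0) (δ : ℝ) (x : ι → SkorokhodSpace) : ℝ :=
  ∑ p : ι × κ, (upperEnvelope (T p.2) δ (x p.1).1 + upperEnvelope (T p.2) δ (-(x p.1).1))

/-- Every value within `δ` of `T` lies between the lower and the upper envelope. The bound does not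
involve `τ`, which is what allows moving times. -/
theorem dist_eval_envelopeVector_le [Fintype ι] [Fintype κ] {T τ : κ → ℝ≥0} {δ : ℝ} (hδ : 0 < δ)
    (hτ : ∀ j, dist (τ j) (T j) ≤ δ) (x : ι → SkorokhodSpace) :
    dist (fun p : ι × κ => (x p.1).1 (τ p.2)) (envelopeVector T δ x) ≤ envelopeGap T δ x := by
  have hup : ∀ p : ι × κ, (x p.1).1 (τ p.2) ≤ upperEnvelope (T p.2) δ (x p.1).1 := fun p =>
    le_upperEnvelope (x p.1).2 hδ (hτ p.2)
  have hlo : ∀ p : ι × κ, -(x p.1).1 (τ p.2) ≤ upperEnvelope (T p.2) δ (-(x p.1).1) := fun p =>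
    le_upperEnvelope (x p.1).2.neg hδ (hτ p.2)
  have hnn : ∀ p : ι × κ, 0 ≤ upperEnvelope (T p.2) δ (x p.1).1 +
      upperEnvelope (T p.2) δ (-(x p.1).1) := fun p => by linarith [hup p, hlo p]
  refine (dist_pi_le_iff (Finset.sum_nonneg fun p _ => hnn p)).2 fun p => ?_
  refine le_trans ?_ (Finset.single_le_sum (fun q _ => hnn q) (Finset.mem_univ p))
  rw [Real.dist_eq, envelopeVector, abs_sub_comm, abs_of_nonneg (by linarith [hup p])]
  linarith [hlo p]

theorem envelopeGap_nonneg [Fintype ι] [Fintype κ] (T : κ → ℝ≥0) {δ : ℝ} (hδ : 0 < δ)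
    (x : ι → SkorokhodSpace) : 0 ≤ envelopeGap T δ x :=
  dist_nonneg.trans (dist_eval_envelopeVector_le hδ (τ := T) (fun j => by simpa using hδ.le) x)

theorem aemeasurable_envelopeVector [Countable ι] [Countable κ] {Ω : Type*} [MeasurableSpace Ω]
    {μ : Measure Ω} {ξ : Ω → ι → SkorokhodSpace}
    (hξ : ∀ i u, AEMeasurable (fun ω => (ξ ω i).1 u) μ) (T : κ → ℝ≥0) {δ : ℝ} (hδ : 0 < δ) :
    AEMeasurable (fun ω => envelopeVector T δ (ξ ω)) μ :=
  aemeasurable_pi_lambda _ fun p =>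
    aemeasurable_upperEnvelope (fun ω => (ξ ω p.1).2) (hξ p.1) (T p.2) hδ

theorem aemeasurable_envelopeGap [Fintype ι] [Fintype κ] {Ω : Type*} [MeasurableSpace Ω]
    {μ : Measure Ω} {ξ : Ω → ι → SkorokhodSpace}
    (hξ : ∀ i u, AEMeasurable (fun ω => (ξ ω i).1 u) μ) (T : κ → ℝ≥0) {δ : ℝ} (hδ : 0 < δ) :
    AEMeasurable (fun ω => envelopeGap T δ (ξ ω)) μ :=
  Finset.aemeasurable_fun_sum _ fun p _ =>
    (aemeasurable_upperEnvelope (fun ω => (ξ ω p.1).2) (hξ p.1) (T p.2) hδ).add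
      (aemeasurable_upperEnvelope (fun ω => (ξ ω p.1).2.neg) (fun u => (hξ p.1 u).neg) (T p.2) hδ)

theorem measurable_eval (i : ι) (u : ℝ≥0) :
    Measurable fun x : ι → SkorokhodSpace => (x i).1 u :=
  ((measurable_pi_apply u).comp (comap_measurable _)).comp (measurable_pi_apply i)

theorem measurable_envelopeVector (T : κ → ℝ≥0) {δ : ℝ} (hδ : 0 < δ) :
    Measurable (envelopeVector T δ : (ι → SkorokhodSpace) → ι × κ → ℝ) :=
  measurable_pi_lambda _ fun p =>
    measurable_upperEnvelope (fun x => (x p.1).2) (measurable_eval p.1) (T p.2) hδ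

theorem measurable_envelopeGap [Fintype ι] [Fintype κ] (T : κ → ℝ≥0) {δ : ℝ} (hδ : 0 < δ) :
    Measurable (envelopeGap T δ : (ι → SkorokhodSpace) → ℝ) :=
  Finset.measurable_fun_sum _ fun p _ =>
    (measurable_upperEnvelope (fun x => (x p.1).2) (measurable_eval p.1) (T p.2) hδ).add
      (measurable_upperEnvelope (fun x => (x p.1).2.neg) (fun u => (measurable_eval p.1 u).neg)
        (T p.2) hδ)

theorem J1Continuous.comp_envelopeVector {f : (ι × κ → ℝ) → ℝ} (hf : Continuous f) (T : κ → ℝ≥0)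
    {δ : ℝ} (hδ : 0 < δ) : J1Continuous fun x : ι → SkorokhodSpace => f (envelopeVector T δ x) :=
  fun _ _ hxy => (hf.tendsto _).comp
    (tendsto_pi_nhds.2 fun p => tendsto_upperEnvelope (hxy p.1) (T p.2) hδ)

theorem J1Continuous.comp_envelopeGap [Fintype ι] [Fintype κ] {f : ℝ → ℝ} (hf : Continuous f)
    (T : κ → ℝ≥0) {δ : ℝ} (hδ : 0 < δ) :
    J1Continuous fun x : ι → SkorokhodSpace => f (envelopeGap T δ x) :=
  fun _ _ hxy => (hf.tendsto _).comp (tendsto_finsetSum _ fun p _ =>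
    (tendsto_upperEnvelope (hxy p.1) (T p.2) hδ).add
      (tendsto_upperEnvelope_neg (hxy p.1) (T p.2) hδ))

theorem tendsto_envelopeGap_of_continuous [Fintype ι] [Fintype κ] (T : κ → ℝ≥0)
    {x : ι → SkorokhodSpace} (hx : ∀ i, Continuous (x i).1) {δ : ℕ → ℝ} (hδ : ∀ n, 0 < δ n)
    (hδ0 : Tendsto δ atTop (𝓝 0)) :
    Tendsto (fun n => envelopeGap T (δ n) x) atTop (𝓝 0) := by
  have : (0 : ℝ) = ∑ p : ι × κ, ((x p.1).1 (T p.2) + (-(x p.1).1) (T p.2)) := by simp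
  rw [this]
  exact tendsto_finsetSum _ fun p _ =>
    (tendsto_upperEnvelope_of_continuous (hx p.1) (T p.2) hδ hδ0).add
      (tendsto_upperEnvelope_of_continuous (hx p.1).neg (T p.2) hδ hδ0)

theorem toSkorokhod_val {x : ℝ≥0 → ℝ} (hx : IsCadlag x) : (toSkorokhod x).1 = x := by
  have : toSkorokhod x = ⟨x, hx⟩ := dif_pos hx
  rw [this]

/-- The order of choice is `k` first, to make the limiting error `g₀ k` small, and then `n`. -/
theorem tendsto_of_forall_approx {a : ℕ → ℝ} {a₀ : ℝ} {b g : ℕ → ℕ → ℝ} {b₀ g₀ : ℕ → ℝ}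
    (hb : ∀ k, Tendsto (b k) atTop (𝓝 (b₀ k))) (hg : ∀ k, Tendsto (g k) atTop (𝓝 (g₀ k)))
    (hg₀ : Tendsto g₀ atTop (𝓝 0)) (hab : ∀ k, ∀ᶠ n in atTop, |a n - b k n| ≤ g k n)
    (hab₀ : ∀ k, |a₀ - b₀ k| ≤ g₀ k) : Tendsto a atTop (𝓝 a₀) := by
  rw [Metric.tendsto_nhds]
  intro r hr
  obtain ⟨k, hk⟩ := (hg₀.eventually_lt_const (show 0 < r / 4 by positivity)).exists
  filter_upwards [Metric.tendsto_nhds.1 (hb k) (r / 4) (by positivity),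
    (hg k).eventually_lt_const hk, hab k] with n h1 h2 h3
  have h4 := hab₀ k
  rw [Real.dist_eq] at h1 ⊢
  rw [abs_lt] at *
  rw [abs_le] at h3 h4
  constructor <;> linarith

theorem integrable_comp_of_continuous_of_bound {E Ω : Type*} [TopologicalSpace E]
    [MeasurableSpace E] [OpensMeasurableSpace E] [MeasurableSpace Ω] {Q : Measure Ω}
    [IsFiniteMeasure Q] {f : E → ℝ} (hf : Continuous f) {C : ℝ} (hC : ∀ v, ‖f v‖ ≤ C) {V : Ω → E}
    (hV : AEMeasurable V Q) : Integrable (fun ω => f (V ω)) Q :=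
  Integrable.of_bound (hf.measurable.comp_aemeasurable hV).aestronglyMeasurable
    C (Eventually.of_forall fun _ => hC _)

/-- For a bounded Lipschitz test function, evaluation is replaced by the envelope vector, at a cost
controlled by the envelope gap. Both are continuous functionals, so the hypothesis applies to each;
the limiting cost vanishes as `δ → 0` because the limit paths are almost surely continuous. -/
theorem TendstoInDistributionD.tendstoInDistribution_eval [Fintype ι] [Fintype κ] {Ω Ω' : Type*}
    [MeasurableSpace Ω] [MeasurableSpace Ω'] {X : ℕ → ι → ℝ≥0 → Ω → ℝ} {Y : ι → ℝ≥0 → Ω' → ℝ}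
    {P : Measure Ω} [IsProbabilityMeasure P] {P' : Measure Ω'} [IsProbabilityMeasure P']
    (hXY : TendstoInDistributionD X Y P P') (hXc : ∀ n i ω, IsCadlag fun u => X n i u ω)
    (hXm : ∀ n i u, Measurable (X n i u))
    (hYc : ∀ i, ∀ᵐ ω ∂P', Continuous fun u => Y i u ω)
    (hYm : ∀ i u, AEMeasurable (Y i u) P')
    {τ : ℕ → κ → ℝ≥0} {T : κ → ℝ≥0} (hτ : ∀ j, Tendsto (fun n => τ n j) atTop (𝓝 (T j))) :
    TendstoInDistribution (fun n ω (p : ι × κ) => X n p.1 (τ n p.2) ω) atTop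
      (fun ω p => Y p.1 (T p.2) ω) (fun _ => P) P' := by
  have hVm : ∀ n, AEMeasurable (fun ω (p : ι × κ) => X n p.1 (τ n p.2) ω) P := fun n =>
    aemeasurable_pi_lambda _ fun p => (hXm n _ _).aemeasurable
  have hVm' : AEMeasurable (fun ω (p : ι × κ) => Y p.1 (T p.2) ω) P' :=
    aemeasurable_pi_lambda _ fun p => hYm _ _
  refine ⟨hVm, hVm', tendsto_iff_forall_lipschitz_integral_tendsto.2 ?_⟩
  rintro f ⟨C, hC⟩ ⟨K, hK⟩
  have hfc := hK.continuous
  simp only [ProbabilityMeasure.coe_mk]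
  rw [integral_map hVm' hfc.aestronglyMeasurable]
  simp_rw [fun n => integral_map (hVm n) hfc.aestronglyMeasurable]
  have hC0 : 0 ≤ C := dist_nonneg.trans (hC 0 0)
  have hfb : ∀ v, ‖f v‖ ≤ |f 0| + C := fun v => by
    have := hC v 0
    rw [Real.dist_eq] at this
    rw [Real.norm_eq_abs]
    have := abs_sub_abs_le_abs_sub (f v) (f 0)
    linarith
  set δ : ℕ → ℝ := fun k => 1 / ((k : ℝ) + 1) with hδdef
  have hδ : ∀ k, 0 < δ k := fun k => by positivity
  have hδ0 : Tendsto δ atTop (𝓝 0) := tendsto_one_div_add_atTop_nhds_zero_nat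
  set ξ : ℕ → Ω → ι → SkorokhodSpace := fun n ω i => toSkorokhod fun u => X n i u ω with hξ
  set ζ : Ω' → ι → SkorokhodSpace := fun ω i => toSkorokhod fun u => Y i u ω with hζ
  have hξv : ∀ n ω i u, (ξ n ω i).1 u = X n i u ω := fun n ω i u => by
    rw [hξ, toSkorokhod_val (hXc n i ω)]
  have hYc' : ∀ᵐ ω ∂P', ∀ i, Continuous fun u => Y i u ω := ae_all_iff.2 hYc
  have hζv : ∀ᵐ ω ∂P', ∀ i, (ζ ω i).1 = fun u => Y i u ω := by
    filter_upwards [hYc'] with ω hω i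
    rw [hζ, toSkorokhod_val (isCadlag_of_continuous (hω i))]
  have hξm : ∀ n i u, AEMeasurable (fun ω => (ξ n ω i).1 u) P := fun n i u => by
    simp_rw [hξv]
    exact (hXm n i u).aemeasurable
  have hζm : ∀ i u, AEMeasurable (fun ω => (ζ ω i).1 u) P' := fun i u =>
    (hYm i u).congr (hζv.mono fun ω hω => by simp only [hω i])
  have hφ : Continuous fun z : ℝ => min C (K * z) := by fun_prop
  -- Capping at `C`, which bounds the oscillation of `f`, loses nothing and makes the gap a bounded
  -- functional, admissible as a test.
  set G : ℕ → (ι → SkorokhodSpace) → ℝ := fun k x => min C (K * envelopeGap T (δ k) x) with hG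
  have hG0 : ∀ k x, 0 ≤ G k x := fun k x =>
    le_min hC0 (mul_nonneg K.2 (envelopeGap_nonneg T (hδ k) x))
  have hGC : ∀ k x, |G k x| ≤ C := fun k x => by
    rw [abs_of_nonneg (hG0 k x)]
    exact min_le_left _ _
  have key : ∀ k (σ : κ → ℝ≥0) (x : ι → SkorokhodSpace), (∀ j, dist (σ j) (T j) ≤ δ k) →
      |f (fun p => (x p.1).1 (σ p.2)) - f (envelopeVector T (δ k) x)| ≤ G k x := by
    intro k σ x hσ
    rw [← Real.dist_eq]
    refine le_min (hC _ _) ((hK.dist_le_mul _ _).trans ?_)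
    gcongr
    exact dist_eval_envelopeVector_le (hδ k) hσ x
  have int_V := fun n => integrable_comp_of_continuous_of_bound hfc hfb (hVm n)
  have int_V' := integrable_comp_of_continuous_of_bound hfc hfb hVm'
  have int_ξ := fun k n => integrable_comp_of_continuous_of_bound hfc hfb
    (aemeasurable_envelopeVector (hξm n) T (hδ k))
  have int_ζ := fun k => integrable_comp_of_continuous_of_bound hfc hfb
    (aemeasurable_envelopeVector hζm T (hδ k))
  have hGξ : ∀ k n, Integrable (fun ω => G k (ξ n ω)) P := fun k n =>
    Integrable.of_bound (hφ.measurable.comp_aemeasurable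
      (aemeasurable_envelopeGap (hξm n) T (hδ k))).aestronglyMeasurable C
      (Eventually.of_forall fun ω => hGC _ _)
  have hGζ : ∀ k, AEStronglyMeasurable (fun ω => G k (ζ ω)) P' := fun k =>
    (hφ.measurable.comp_aemeasurable
      (aemeasurable_envelopeGap hζm T (hδ k))).aestronglyMeasurable
  refine tendsto_of_forall_approx
    (b := fun k n => ∫ ω, f (envelopeVector T (δ k) (ξ n ω)) ∂P)
    (b₀ := fun k => ∫ ω, f (envelopeVector T (δ k) (ζ ω)) ∂P')
    (g := fun k n => ∫ ω, G k (ξ n ω) ∂P) (g₀ := fun k => ∫ ω, G k (ζ ω) ∂P')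
    (fun k => hXY _ (hfc.measurable.comp (measurable_envelopeVector T (hδ k)))
      ⟨_, fun x => hfb _⟩ (J1Continuous.comp_envelopeVector hfc T (hδ k)))
    (fun k => hXY _ (hφ.measurable.comp (measurable_envelopeGap T (hδ k)))
      ⟨C, hGC k⟩ (J1Continuous.comp_envelopeGap hφ T (hδ k))) ?_ (fun k => ?_) (fun k => ?_)
  · rw [← integral_zero Ω' ℝ (μ := P')]
    refine tendsto_integral_of_dominated_convergence (fun _ => C) hGζ (integrable_const _)
      (fun k => Eventually.of_forall fun ω => hGC _ _) ?_
    filter_upwards [hYc', hζv] with ω h1 h2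
    have h3 := tendsto_envelopeGap_of_continuous T (x := ζ ω)
      (fun i => by rw [h2 i]; exact h1 i) hδ hδ0
    have h4 := (hφ.tendsto 0).comp h3
    rwa [mul_zero, min_eq_right hC0] at h4
  · have hev : ∀ᶠ n in atTop, ∀ j, dist (τ n j) (T j) ≤ δ k :=
      eventually_all.2 fun j => (Metric.tendsto_nhds.1 (hτ j) (δ k) (hδ k)).mono fun n hn => hn.le
    filter_upwards [hev] with n hn
    rw [← integral_sub (int_V n) (int_ξ k n)]
    refine abs_integral_le_integral_abs.trans
      (integral_mono ((int_V n).sub (int_ξ k n)).abs (hGξ k n) fun ω => ?_)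
    have := key k (τ n) (ξ n ω) hn
    simp_rw [hξv] at this
    exact this
  · rw [← integral_sub int_V' (int_ζ k)]
    refine abs_integral_le_integral_abs.trans (integral_mono_ae (int_V'.sub (int_ζ k)).abs
      (Integrable.of_bound (hGζ k) C (Eventually.of_forall fun ω => hGC _ _)) ?_)
    filter_upwards [hζv] with ω hω
    have := key k T (ζ ω) (fun j => by simpa using (hδ k).le)
    simp_rw [hω] at this
    exact this

end Eval

/-! ### Convergence in distribution -/

section Distribution

variable {ι E F Ω' : Type*} {Ω : ι → Type*} {m : ∀ i, MeasurableSpace (Ω i)}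
  {μ : (i : ι) → Measure (Ω i)} [∀ i, IsProbabilityMeasure (μ i)] {m' : MeasurableSpace Ω'}
  {μ' : Measure Ω'} [IsProbabilityMeasure μ'] [TopologicalSpace E] {mE : MeasurableSpace E}
  [OpensMeasurableSpace E] {X Y : (i : ι) → Ω i → E} {Z : Ω' → E} {l : Filter ι}

/-- **Continuous mapping theorem** for a map that is almost surely continuous at the limit. -/
theorem tendstoInDistribution_comp_of_ae_continuousAt [HasOuterApproxClosed E]
    [l.IsCountablyGenerated] [TopologicalSpace F] [MeasurableSpace F] [OpensMeasurableSpace F]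
    {g : E → F} (hg : Measurable g) (h : TendstoInDistribution X l Z μ μ')
    (hgc : ∀ᵐ ω ∂μ', ContinuousAt g (Z ω)) :
    TendstoInDistribution (fun n ω => g (X n ω)) l (fun ω => g (Z ω)) μ μ' where
  forall_aemeasurable n := hg.comp_aemeasurable (h.forall_aemeasurable n)
  aemeasurable_limit := hg.comp_aemeasurable h.aemeasurable_limit
  tendsto := by
    have hgX : ∀ n, AEMeasurable (fun ω => g (X n ω)) (μ n) := fun n =>
      hg.comp_aemeasurable (h.forall_aemeasurable n)
    have hgZ : AEMeasurable (fun ω => g (Z ω)) μ' := hg.comp_aemeasurable h.aemeasurable_limit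
    refine tendsto_of_forall_isClosed_limsup_le' fun S hS => ?_
    simp only [ProbabilityMeasure.coe_mk]
    have hcl : IsClosed (closure (g ⁻¹' S)) := isClosed_closure
    calc limsup (fun n => (μ n).map (fun ω => g (X n ω)) S) l
        ≤ limsup (fun n => (μ n).map (X n) (closure (g ⁻¹' S))) l := by
          refine limsup_le_limsup (Eventually.of_forall fun n => ?_)
          beta_reduce
          rw [Measure.map_apply_of_aemeasurable (hgX n) hS.measurableSet,
            Measure.map_apply_of_aemeasurable (h.forall_aemeasurable n)
            hcl.measurableSet]
          exact measure_mono fun ω hω => subset_closure hω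
      _ ≤ μ'.map Z (closure (g ⁻¹' S)) :=
          ProbabilityMeasure.limsup_measure_closed_le_of_tendsto h.tendsto hcl
      _ ≤ μ'.map (fun ω => g (Z ω)) S := by
          rw [Measure.map_apply_of_aemeasurable hgZ hS.measurableSet,
            Measure.map_apply_of_aemeasurable h.aemeasurable_limit
            hcl.measurableSet]
          -- At a continuity point of `g` in the closure of `g ⁻¹' S`, the value of `g` lies in the
          -- closure of `S`, which is `S`.
          refine measure_mono_ae ?_
          filter_upwards [hgc] with ω hω hmem
          have h1 := hω.continuousWithinAt.mem_closure_image hmem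
          exact hS.closure_subset_iff.2 (Set.image_preimage_subset g S) h1

theorem tendstoInDistribution_congr_of_eventually (h : TendstoInDistribution X l Z μ μ')
    (hY : ∀ n, AEMeasurable (Y n) (μ n)) (hXY : ∀ᶠ n in l, X n = Y n) :
    TendstoInDistribution Y l Z μ μ' where
  forall_aemeasurable := hY
  aemeasurable_limit := h.aemeasurable_limit
  tendsto := h.tendsto.congr' (hXY.mono fun n hn => Subtype.ext (by simp only [hn]))

theorem tendstoInDistribution_of_identDistrib_limit {Ω'' : Type*} {m'' : MeasurableSpace Ω''}
    {μ'' : Measure Ω''} [IsProbabilityMeasure μ''] {Z' : Ω'' → E}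
    (h : TendstoInDistribution X l Z μ μ') (hZ : IdentDistrib Z Z' μ' μ'') :
    TendstoInDistribution X l Z' μ μ'' where
  forall_aemeasurable := h.forall_aemeasurable
  aemeasurable_limit := hZ.aemeasurable_snd
  tendsto := by
    have := h.tendsto
    simp only [hZ.map_eq] at this
    exact this

theorem tendstoInMeasure_pi {Ω κ ι : Type*} [Fintype κ] [MeasurableSpace Ω] {μ : Measure Ω}
    {l : Filter ι} {f : ι → κ → Ω → ℝ} {g : κ → Ω → ℝ}
    (h : ∀ j, TendstoInMeasure μ (fun n => f n j) l (g j)) :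
    TendstoInMeasure μ (fun n ω j => f n j ω) l (fun ω j => g j ω) := by
  intro r hr
  have h0 : Tendsto (fun n => ∑ j, μ {ω | r ≤ edist (f n j ω) (g j ω)}) l (𝓝 0) := by
    simpa using tendsto_finsetSum Finset.univ fun j _ => h j r hr
  refine tendsto_of_tendsto_of_tendsto_of_le_of_le tendsto_const_nhds h0 (fun _ => zero_le)
    fun n => ?_
  refine (measure_mono ?_).trans (measure_iUnion_fintype_le μ _)
  intro ω hω
  by_contra hcon
  simp only [Set.mem_iUnion, Set.mem_ofPred_eq, not_exists, not_le] at hcon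
  have hω' : r ≤ edist (fun j => f n j ω) (fun j => g j ω) := hω
  rw [edist_pi_def] at hω'
  exact absurd hω' (not_le.2 ((Finset.sup_lt_iff hr).2 fun j _ => hcon j))

end Distribution

/-! ### The limiting contrast of a Brownian motion -/

section Contrast

/-- The contrast `x(1/β + t) - x(1/β + t - 1) - β x(1/β)` of a path. -/
def contrast (β t : ℝ) (x : ℝ≥0 → ℝ) : ℝ :=
  x (1 / β + t).toNNReal - x (1 / β + t - 1).toNNReal - β * x (1 / β).toNNReal

theorem measurable_contrast (β t : ℝ) : Measurable (contrast β t) := by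
  unfold contrast
  fun_prop

variable {Ω Ω' : Type*} [MeasurableSpace Ω] [MeasurableSpace Ω'] {P : Measure Ω} {P' : Measure Ω'}

theorem aemeasurable_contrast {B : ℝ≥0 → Ω → ℝ} (hB : IsPreBrownianReal B P) (β t : ℝ) :
    AEMeasurable (fun ω => contrast β t fun u => B u ω) P := by
  unfold contrast
  exact ((hB.aemeasurable _).sub (hB.aemeasurable _)).sub ((hB.aemeasurable _).const_mul _)

theorem identDistrib_contrast {B : ℝ≥0 → Ω → ℝ} {B' : ℝ≥0 → Ω' → ℝ}
    (hB : IsPreBrownianReal B P) (hB' : IsPreBrownianReal B' P') (β t : ℝ) :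
    IdentDistrib (fun ω => contrast β t fun u => B u ω) (fun ω => contrast β t fun u => B' u ω)
      P P' := by
  let I : Finset ℝ≥0 := {(1 / β + t).toNNReal, (1 / β + t - 1).toNNReal, (1 / β).toNNReal}
  have h : IdentDistrib (fun ω => I.restrict (B · ω)) (fun ω => I.restrict (B' · ω)) P P' :=
    ⟨(hB.hasLaw I).aemeasurable, (hB'.hasLaw I).aemeasurable,
      (hB.hasLaw I).map_eq.trans (hB'.hasLaw I).map_eq.symm⟩
  have hL : Measurable fun v : I → ℝ => v ⟨(1 / β + t).toNNReal, by simp [I]⟩ -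
      v ⟨(1 / β + t - 1).toNNReal, by simp [I]⟩ - β * v ⟨(1 / β).toNNReal, by simp [I]⟩ := by
    fun_prop
  exact h.comp hL

theorem variance_contrast_pos [IsProbabilityMeasure P] {B : ℝ≥0 → Ω → ℝ}
    (hB : IsPreBrownianReal B P) {β t : ℝ} (hβ : 0 < β) (hβ1 : β ≤ 1) (ht : 0 < t) :
    0 < Var[fun ω => contrast β t fun u => B u ω; P] := by
  have hL : ∀ u, MemLp (fun ω => B u ω) 2 P := fun u =>
    (hB.isGaussianProcess.hasGaussianLaw_eval u).memLp_two
  have h1 : 1 ≤ 1 / β := (le_div_iff₀ hβ).2 (by linarith)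
  have hp : ((1 / β + t).toNNReal : ℝ) = 1 / β + t := Real.coe_toNNReal _ (by linarith)
  have hq : ((1 / β + t - 1).toNNReal : ℝ) = 1 / β + t - 1 := Real.coe_toNNReal _ (by linarith)
  have ha : ((1 / β).toNNReal : ℝ) = 1 / β := Real.coe_toNNReal _ (by linarith)
  unfold contrast
  have hV : Var[fun ω => B (1 / β + t).toNNReal ω - B (1 / β + t - 1).toNNReal ω -
      β * B (1 / β).toNNReal ω; P] =
      1 + β - 2 * β * (1 / β - min (1 / β + t - 1) (1 / β)) := by
    have hd : MemLp (fun ω => B (1 / β + t).toNNReal ω - B (1 / β + t - 1).toNNReal ω) 2 P :=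
      (hL _).sub (hL _)
    rw [variance_fun_sub hd ((hL _).const_mul β),
      variance_fun_sub (hL _) (hL _), variance_const_mul, covariance_const_mul_right,
      covariance_fun_sub_left (hL _) (hL _) (hL _), ← covariance_self (hL _).aemeasurable,
      ← covariance_self (hL _).aemeasurable, ← covariance_self (hL _).aemeasurable]
    simp only [hB.covariance_fun_eval, NNReal.coe_min, hp, hq, ha, min_self]
    rw [min_eq_right (show 1 / β + t - 1 ≤ 1 / β + t by linarith),
      min_eq_right (show 1 / β ≤ 1 / β + t by linarith)]
    have : β ^ 2 * (1 / β) = β := by field_simp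
    rw [this]
    ring
  rw [hV]
  -- The variance is `1 - β + 2βt` when `t ≤ 1`, where the window reaches back into the historical
  -- period, and `1 + β` when `t ≥ 1`.
  rcases le_total (1 / β + t - 1) (1 / β) with h | h
  · rw [min_eq_left h]
    nlinarith [mul_pos hβ ht]
  · rw [min_eq_right h]
    linarith

/-- The contrast is a linear image of a Gaussian vector and has positive variance, so its law has no
atoms. -/
theorem ae_contrast_ne [IsProbabilityMeasure P] {B : ℝ≥0 → Ω → ℝ}
    (hB : IsPreBrownianReal B P) {β t : ℝ} (hβ : 0 < β) (hβ1 : β ≤ 1) (ht : 0 < t) (z : ℝ) :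
    ∀ᵐ ω ∂P, (contrast β t fun u => B u ω) ≠ z := by
  let I : Finset ℝ≥0 := {(1 / β + t).toNNReal, (1 / β + t - 1).toNNReal, (1 / β).toNNReal}
  let L : (I → ℝ) →L[ℝ] ℝ := ContinuousLinearMap.proj ⟨(1 / β + t).toNNReal, by simp [I]⟩ -
    ContinuousLinearMap.proj ⟨(1 / β + t - 1).toNNReal, by simp [I]⟩ -
    β • ContinuousLinearMap.proj ⟨(1 / β).toNNReal, by simp [I]⟩
  have hG : HasGaussianLaw (fun ω => contrast β t fun u => B u ω) P :=
    (hB.isGaussianProcess.hasGaussianLaw I).map L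
  have hv := variance_contrast_pos hB hβ hβ1 ht
  have hmap := hG.map_eq_gaussianReal
  have := nullSingletonClass_gaussianReal (μ := P[fun ω => contrast β t fun u => B u ω])
    (Real.toNNReal_pos.2 hv).ne'
  rw [← hmap] at this
  have h0 : P.map (fun ω => contrast β t fun u => B u ω) {z} = 0 := measure_singleton z
  rw [Measure.map_apply_of_aemeasurable (aemeasurable_contrast hB β t)
    (measurableSet_singleton z)] at h0
  exact compl_mem_ae_iff.2 h0

theorem identDistrib_pi_of_iIndepFun {ι : Type*} [Fintype ι] [IsProbabilityMeasure P]
    [IsProbabilityMeasure P'] {U : ι → Ω → ℝ} {V : ι → Ω' → ℝ} (hU : iIndepFun U P)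
    (hV : iIndepFun V P') (h : ∀ i, IdentDistrib (U i) (V i) P P') :
    IdentDistrib (fun ω i => U i ω) (fun ω i => V i ω) P P' where
  aemeasurable_fst := aemeasurable_pi_lambda _ fun i => (h i).aemeasurable_fst
  aemeasurable_snd := aemeasurable_pi_lambda _ fun i => (h i).aemeasurable_snd
  map_eq := by
    rw [(iIndepFun_iff_map_fun_eq_pi_map fun i => (h i).aemeasurable_fst).1 hU,
      (iIndepFun_iff_map_fun_eq_pi_map fun i => (h i).aemeasurable_snd).1 hV]
    simp only [(h _).map_eq]

/-- Brownian scaling gives equality in law for each stream; independence upgrades it to the joint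
law. -/
theorem identDistrib_contrast_scaled {ι : Type*} [Fintype ι] [IsProbabilityMeasure P]
    {W : ι → ℝ≥0 → Ω → ℝ} (hW : ∀ i, IsPreBrownianReal (W i) P)
    (hind : iIndepFun (fun i ω u => W i u ω) P) (β t : ℝ) {a : ℝ≥0} (ha : a ≠ 0) :
    IdentDistrib (fun ω i => contrast β t fun u => (√a)⁻¹ * W i (a * u) ω)
      (fun ω i => contrast β t fun u => W i u ω) P P := by
  refine identDistrib_pi_of_iIndepFun
    (hind.comp (fun _ x => contrast β t fun u => (√a)⁻¹ * x (a * u)) fun _ => ?_)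
    (hind.comp (fun _ x => contrast β t x) fun _ => measurable_contrast β t)
    fun i => identDistrib_contrast ((hW i).smul ha) (hW i) β t
  exact (measurable_contrast β t).comp (by fun_prop)

end Contrast

/-! ### The global statistics as functions of the local ones -/

section Aggregation

variable {ι : Type*} [Fintype ι]

/-- The weighted Euclidean norm of the local statistics. -/
def aggregate (q : ℝ × (ι → ℝ)) : ℝ := q.1 * √(∑ i, q.2 i ^ 2)

open scoped Classical in
/-- The weighted Euclidean norm of the local statistics whose weighted value exceeds `c`. -/
def aggregateAbove (c : ℝ) (q : ℝ × (ι → ℝ)) : ℝ :=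
  q.1 * √(∑ i, q.2 i ^ 2 * (if q.1 * q.2 i > c then 1 else 0))

theorem continuous_aggregate : Continuous (aggregate : ℝ × (ι → ℝ) → ℝ) := by
  unfold aggregate
  fun_prop

theorem measurable_aggregateAbove (c : ℝ) :
    Measurable (aggregateAbove c : ℝ × (ι → ℝ) → ℝ) := by
  unfold aggregateAbove
  refine measurable_fst.mul (Finset.measurable_fun_sum _ fun i _ => ?_).sqrt
  refine Measurable.mul (by fun_prop) (Measurable.ite ?_ measurable_const measurable_const)
  exact measurableSet_lt measurable_const (by fun_prop)

theorem abs_aggregateAbove_le (c : ℝ) (q : ℝ × (ι → ℝ)) :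
    |aggregateAbove c q| ≤ |aggregate q| := by
  unfold aggregateAbove aggregate
  rw [abs_mul, abs_mul, abs_of_nonneg (Real.sqrt_nonneg _), abs_of_nonneg (Real.sqrt_nonneg _)]
  gcongr with i
  refine mul_le_of_le_one_right (sq_nonneg _) ?_
  split_ifs <;> norm_num

/-- Off the threshold each indicator is locally constant. -/
theorem continuousAt_aggregateAbove_of_ne {c : ℝ} {q : ℝ × (ι → ℝ)} (hq : ∀ i, q.1 * q.2 i ≠ c) :
    ContinuousAt (aggregateAbove c) q := by
  classical
  have hind : ∀ i, ContinuousAt (fun p : ℝ × (ι → ℝ) =>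
      if p.1 * p.2 i > c then (1 : ℝ) else 0) q := by
    intro i
    have hc : ContinuousAt (fun p : ℝ × (ι → ℝ) => p.1 * p.2 i) q := by fun_prop
    rcases lt_or_gt_of_ne (hq i) with h | h
    · refine (continuousAt_const (y := (0 : ℝ))).congr ?_
      filter_upwards [hc.eventually_lt_const h] with p hp
      rw [if_neg (not_lt.2 hp.le)]
    · refine (continuousAt_const (y := (1 : ℝ))).congr ?_
      filter_upwards [hc.eventually_const_lt h] with p hp
      rw [if_pos hp]
  have hsum : ContinuousAt (fun p : ℝ × (ι → ℝ) =>
      ∑ i, p.2 i ^ 2 * (if p.1 * p.2 i > c then (1 : ℝ) else 0)) q :=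
    tendsto_finsetSum _ fun i _ => ContinuousAt.mul (by fun_prop) (hind i)
  have hmul : ContinuousAt (fun p : ℝ × (ι → ℝ) =>
      p.1 * √(∑ i, p.2 i ^ 2 * (if p.1 * p.2 i > c then (1 : ℝ) else 0))) q :=
    continuousAt_fst.mul hsum.sqrt
  unfold aggregateAbove
  convert hmul

/-- The indicators only decrease the norm, so the value is squeezed by `aggregate`, which is
continuous and zero at `q`. -/
theorem continuousAt_aggregateAbove_of_fst_eq_zero (c : ℝ) {q : ℝ × (ι → ℝ)} (hq : q.1 = 0) :
    ContinuousAt (aggregateAbove c) q := by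
  have h0 : aggregateAbove c q = 0 := by simp [aggregateAbove, hq]
  have h1 : Tendsto (fun p => |aggregate p|) (𝓝 q) (𝓝 0) := by
    have := (continuous_aggregate.tendsto q).abs
    rwa [show aggregate q = 0 by simp [aggregate, hq], abs_zero] at this
  rw [ContinuousAt, h0]
  exact squeeze_zero_norm (fun p => abs_aggregateAbove_le c p) h1

variable {Ω : Type*}

/-- The local statistics on the scale on which they converge. -/
def scaledLocalStat (X : ι → ℕ → Ω → ℝ) (σhat : ι → Ω → ℝ) (m k h : ℕ) (ω : Ω) (i : ι) : ℝ :=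
  1 / √(h : ℝ) * localStat X σhat m k h i ω

theorem weight_mul_centralizedStat (ρ : ℝ → ℝ) (X : ι → ℕ → Ω → ℝ) (σhat : ι → Ω → ℝ)
    (m k h : ℕ) (ω : Ω) :
    weight ρ k h * centralizedStat X σhat m k h ω =
      aggregate (ρ ((k : ℝ) / h), scaledLocalStat X σhat m k h ω) := by
  simp only [weight, centralizedStat, aggregate, scaledLocalStat, mul_pow]
  rw [← Finset.mul_sum, Real.sqrt_mul (by positivity), Real.sqrt_sq (by positivity)]
  ring

theorem weight_mul_distributedStat (ρ : ℝ → ℝ) (c : ℝ) (X : ι → ℕ → Ω → ℝ) (σhat : ι → Ω → ℝ)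
    (m k h : ℕ) (ω : Ω) :
    weight ρ k h * distributedStat ρ c X σhat m k h ω =
      aggregateAbove c (ρ ((k : ℝ) / h), scaledLocalStat X σhat m k h ω) := by
  have hw : ∀ i, ρ ((k : ℝ) / h) * (1 / √(h : ℝ) * localStat X σhat m k h i ω) =
      weight ρ k h * localStat X σhat m k h i ω := fun i => by rw [weight]; ring
  simp only [distributedStat, aggregateAbove, scaledLocalStat, mul_pow, mul_assoc, hw]
  rw [← Finset.mul_sum, Real.sqrt_mul (by positivity), Real.sqrt_sq (by positivity), weight]
  ring

end Aggregation

/-! ### The local statistics as functions of the partial sums -/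

section Local

variable {ι Ω : Type*}

/-- The scaled local statistics as a function of the partial sums at three times, the ratio
`a = h / m`, the factor `b = √(m / h)` and the estimators. -/
def localMap (q : ((ι × Fin 3 → ℝ) × (ℝ × ℝ × ℝ)) × (ι → ℝ)) : ℝ × (ι → ℝ) :=
  (q.1.2.2.2, fun i => q.1.2.2.1 * (1 / q.2 i *
    |q.1.1 (i, 0) - q.1.1 (i, 1) - q.1.2.1 * q.1.1 (i, 2)|))

theorem measurable_localMap :
    Measurable (localMap : ((ι × Fin 3 → ℝ) × (ℝ × ℝ × ℝ)) × (ι → ℝ) → ℝ × (ι → ℝ)) := by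
  unfold localMap
  refine Measurable.prodMk (by fun_prop) (measurable_pi_lambda _ fun i => ?_)
  refine Measurable.mul (by fun_prop) (Measurable.mul ?_ ?_)
  · exact measurable_const.div (by fun_prop)
  · exact Measurable.abs (by fun_prop)

theorem continuousAt_localMap {q : ((ι × Fin 3 → ℝ) × (ℝ × ℝ × ℝ)) × (ι → ℝ)}
    (hq : ∀ i, q.2 i ≠ 0) : ContinuousAt localMap q := by
  unfold localMap
  refine ContinuousAt.prodMk (by fun_prop) (continuousAt_pi.2 fun i => ?_)
  refine ContinuousAt.mul (by fun_prop) (ContinuousAt.mul ?_ (by fun_prop))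
  exact continuousAt_const.div (by fun_prop) (hq i)

theorem scaledSum_natCast_div (ε : ι → ℕ → Ω → ℝ) {m : ℕ} (hm : m ≠ 0) (n : ℕ) (i : ι) (ω : Ω) :
    scaledSum ε m i ((n : ℝ≥0) / m) ω = 1 / √(m : ℝ) * ∑ s ∈ Finset.Icc 1 n, ε i s ω := by
  have : (m : ℝ) * (((n : ℝ≥0) / m : ℝ≥0) : ℝ) = n := by
    push_cast
    have : (m : ℝ) ≠ 0 := by exact_mod_cast hm
    field_simp
  rw [scaledSum, partialSum, this, Nat.floor_natCast]

theorem measurable_scaledSum [MeasurableSpace Ω] {ε : ι → ℕ → Ω → ℝ}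
    (hε : ∀ i s, Measurable (ε i s)) (m : ℕ) (i : ι) (u : ℝ≥0) :
    Measurable (scaledSum ε m i u) := by
  unfold scaledSum partialSum
  exact (Finset.measurable_fun_sum _ fun s _ => hε i s).const_mul _

/-- The three times, in units of the length `m` of the historical period, at which the partial
sums determine the local statistics. -/
def times (m k h : ℕ) : Fin 3 → ℝ≥0 :=
  ![((m + k : ℕ) : ℝ≥0) / m, ((m + k - h : ℕ) : ℝ≥0) / m, (m : ℝ≥0) / m]

theorem sum_Icc_sub (f : ℕ → ℝ) {a b : ℕ} (hab : a ≤ b) :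
    ∑ s ∈ Finset.Icc (a + 1) b, f s = ∑ s ∈ Finset.Icc 1 b, f s - ∑ s ∈ Finset.Icc 1 a, f s := by
  have hf : ∀ n, ∑ s ∈ Finset.Icc 1 n, f s = ∑ s ∈ Finset.Ioc 0 n, f s := fun n => rfl
  rw [hf, hf, ← Finset.sum_Ioc_consecutive f (Nat.zero_le a) hab, add_sub_cancel_left,
    Finset.Icc_add_one_left_eq_Ioc]

theorem scaledLocalStat_eq {X ε : ι → ℕ → Ω → ℝ} {μ : ι → ℝ} (hX : NullModel X μ ε)
    (σhat : ι → Ω → ℝ) {m k h : ℕ} (hm : m ≠ 0) (hh : h ≤ m + k) (r : ℝ) (ω : Ω) :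
    localMap (((fun p => scaledSum ε m p.1 (times m k h p.2) ω),
      ((h : ℝ) / m, √((m : ℝ) / h), r)), fun i => σhat i ω) =
      (r, scaledLocalStat X σhat m k h ω) := by
  have hm' : (m : ℝ) ≠ 0 := by exact_mod_cast hm
  have hsm : 0 < √(m : ℝ) := Real.sqrt_pos.2 (by positivity)
  refine Prod.ext rfl (funext fun i => ?_)
  have hsum : ∀ n, ∑ s ∈ Finset.Icc 1 n, X i s ω = n * μ i + ∑ s ∈ Finset.Icc 1 n, ε i s ω := by
    intro n
    rw [Finset.sum_congr rfl fun s hs => hX i s ω (Finset.mem_Icc.1 hs).1,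
      Finset.sum_add_distrib]
    simp
  simp only [localMap, times, scaledLocalStat, localStat, Matrix.cons_val_zero,
    Matrix.cons_val_one, Matrix.cons_val, scaledSum_natCast_div ε hm]
  rw [sum_Icc_sub _ (Nat.sub_le _ _), hsum, hsum, hsum, Nat.cast_sub hh]
  set A := ∑ s ∈ Finset.Icc 1 (m + k), ε i s ω
  set B := ∑ s ∈ Finset.Icc 1 (m + k - h), ε i s ω
  set D := ∑ s ∈ Finset.Icc 1 m, ε i s ω
  -- The window contributes `h μ_i` and the historical sum `(h/m) m μ_i`, which cancel.
  have e1 : (↑(m + k) * μ i + A - ((↑(m + k) - (h : ℝ)) * μ i + B) - h / m * (m * μ i + D)) =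
      A - B - h / m * D := by
    field_simp
    ring
  have e2 : 1 / √(m : ℝ) * A - 1 / √(m : ℝ) * B - h / m * (1 / √(m : ℝ) * D) =
      1 / √(m : ℝ) * (A - B - h / m * D) := by ring
  rw [e1, e2, abs_mul, abs_of_pos (by positivity : 0 < 1 / √(m : ℝ)),
    Real.sqrt_div (Nat.cast_nonneg m)]
  field_simp

theorem measurable_localStat [MeasurableSpace Ω] {X ε : ι → ℕ → Ω → ℝ} {μ : ι → ℝ}
    (hX : NullModel X μ ε) (hε : ∀ i s, Measurable (ε i s)) {σhat : ι → Ω → ℝ}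
    (hσhat : ∀ i, Measurable (σhat i)) (m k h : ℕ) (i : ι) :
    Measurable (localStat X σhat m k h i) := by
  have hXm : ∀ s, 1 ≤ s → Measurable (X i s) := fun s hs => by
    rw [show X i s = fun ω => μ i + ε i s ω from funext fun ω => hX i s ω hs]
    exact (hε i s).const_add _
  have hsum : ∀ a b, 1 ≤ a → Measurable fun ω => ∑ s ∈ Finset.Icc a b, X i s ω := fun a b ha =>
    Finset.measurable_fun_sum _ fun s hs => hXm s (ha.trans (Finset.mem_Icc.1 hs).1)
  unfold localStat
  exact (measurable_const.div (hσhat i)).mul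
    ((hsum _ _ (Nat.le_add_left 1 _)).sub ((hsum 1 m le_rfl).const_mul _)).abs

end Local

/-! ### The asymptotic regime -/

section Regime

variable {h : ℕ → ℕ} {β t : ℝ}

theorem AsymptoticRegime.tendsto_floor_div_window (hr : AsymptoticRegime h β) (ht : 0 < t) :
    Tendsto (fun m => (⌊h m * t⌋₊ : ℝ) / h m) atTop (𝓝 t) := by
  have := (tendsto_nat_floor_mul_div_atTop ht.le).comp
    (tendsto_natCast_atTop_atTop.comp hr.window_tendsto)
  refine this.congr fun m => ?_
  simp only [Function.comp_apply, mul_comm t]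

theorem AsymptoticRegime.tendsto_floor_div (hr : AsymptoticRegime h β) (ht : 0 < t) :
    Tendsto (fun m : ℕ => (⌊h m * t⌋₊ : ℝ) / m) atTop (𝓝 (t * β)) := by
  refine ((hr.tendsto_floor_div_window ht).mul hr.ratio_tendsto).congr' ?_
  filter_upwards [hr.window_tendsto.eventually_ge_atTop 1] with m hm
  have : (h m : ℝ) ≠ 0 := by positivity
  field_simp

/-- Since `(h - k)/m → β(1 - t) < 1`, the truncated subtraction in `m + k - h` is eventually a true
one. -/
theorem AsymptoticRegime.eventually_window_le (hr : AsymptoticRegime h β) (ht : 0 < t) :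
    ∀ᶠ m in atTop, h m ≤ m + ⌊h m * t⌋₊ := by
  have h1 : Tendsto (fun m : ℕ => (h m : ℝ) / m - (⌊h m * t⌋₊ : ℝ) / m) atTop (𝓝 (β - t * β)) :=
    hr.ratio_tendsto.sub (hr.tendsto_floor_div ht)
  have h2 : β - t * β < 1 := by nlinarith [hr.le_one, mul_pos ht hr.pos]
  filter_upwards [h1.eventually_lt_const h2, eventually_gt_atTop 0] with m hm hm0
  have hm' : (0 : ℝ) < m := by exact_mod_cast hm0
  rw [← sub_div, div_lt_one hm'] at hm
  have : (h m : ℝ) ≤ ((m + ⌊h m * t⌋₊ : ℕ) : ℝ) := by push_cast; linarith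
  exact_mod_cast this

theorem AsymptoticRegime.tendsto_times (hr : AsymptoticRegime h β) (ht : 0 < t) (j : Fin 3) :
    Tendsto (fun m => times m ⌊h m * t⌋₊ (h m) j) atTop
      (𝓝 (![(1 + t * β).toNNReal, (1 + t * β - β).toNNReal, 1] j)) := by
  have hpos := mul_pos ht hr.pos
  have h1 : Tendsto (fun m : ℕ => (m : ℝ) / m) atTop (𝓝 1) :=
    tendsto_const_nhds.congr' ((eventually_gt_atTop 0).mono fun m hm =>
      (div_self (by positivity)).symm)
  rw [← NNReal.tendsto_coe]
  fin_cases j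
  · simp only [times, Fin.zero_eta, Matrix.cons_val_zero]
    rw [Real.coe_toNNReal _ (by linarith)]
    refine (h1.add (hr.tendsto_floor_div ht)).congr fun m => ?_
    push_cast
    ring
  · simp only [times, Fin.mk_one, Matrix.cons_val_one, Matrix.cons_val_zero]
    rw [Real.coe_toNNReal _ (by linarith [hr.le_one])]
    refine ((h1.add (hr.tendsto_floor_div ht)).sub hr.ratio_tendsto).congr' ?_
    filter_upwards [hr.eventually_window_le ht] with m hm
    rw [NNReal.coe_div, NNReal.coe_natCast, NNReal.coe_natCast, Nat.cast_sub hm]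
    push_cast
    ring
  · simpa [times] using h1

theorem AsymptoticRegime.tendsto_sqrt (hr : AsymptoticRegime h β) :
    Tendsto (fun m : ℕ => √((m : ℝ) / h m)) atTop (𝓝 (√β)⁻¹) := by
  rw [← Real.sqrt_inv]
  refine ((hr.ratio_tendsto.inv₀ hr.pos.ne').congr fun m => ?_).sqrt
  rw [inv_div]

end Regime

/-! ### The limit of the local statistics -/

section Limit

variable {ι Ω Ω' : Type*}

/-- The three limit times are `β` times those of the contrast, and the factor `1/√β`, the limit of
`√(m/h)`, is exactly the normalization of Brownian scaling. The constants `σ i` cancel. -/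
theorem localMap_limit {σ : ι → ℝ} (hσ : ∀ i, 0 < σ i) (W : ι → ℝ≥0 → Ω' → ℝ) {β : ℝ}
    (hβ : 0 < β) (t r : ℝ) (ω : Ω') :
    localMap (((fun p => σ p.1 * W p.1
      (![(1 + t * β).toNNReal, (1 + t * β - β).toNNReal, 1] p.2) ω), (β, (√β)⁻¹, r)), σ) =
      (r, fun i => |contrast β t fun u => (√β.toNNReal)⁻¹ * W i (β.toNNReal * u) ω|) := by
  refine Prod.ext rfl (funext fun i => ?_)
  have hs : ∀ x y : ℝ, β * x = y → β.toNNReal * x.toNNReal = y.toNNReal := fun x y h => by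
    rw [← h, Real.toNNReal_mul hβ.le]
  simp only [localMap, contrast, Matrix.cons_val_zero, Matrix.cons_val_one, Matrix.cons_val]
  rw [hs (1 / β + t) (1 + t * β) (by field_simp),
    hs (1 / β + t - 1) (1 + t * β - β) (by field_simp),
    hs (1 / β) 1 (by field_simp), Real.toNNReal_one, Real.coe_toNNReal _ hβ.le]
  have hb : 0 < (√β)⁻¹ := inv_pos.2 (Real.sqrt_pos.2 hβ)
  have e1 : ∀ x y z : ℝ, σ i * x - σ i * y - β * (σ i * z) = σ i * (x - y - β * z) := by
    intros; ring
  have e2 : ∀ x y z : ℝ, (√β)⁻¹ * x - (√β)⁻¹ * y - β * ((√β)⁻¹ * z) =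
      (√β)⁻¹ * (x - y - β * z) := by
    intros; ring
  have := (hσ i).ne'
  rw [e1, e2, abs_mul, abs_mul, abs_of_pos (hσ i), abs_of_pos hb]
  field_simp

/-- Slutsky's lemma adjoins the deterministic parameters and the estimators to the partial sums. The
value of `ρ` is carried as a coordinate because the indicators of the distributed case depend on it.
-/
theorem tendstoInDistribution_scaledLocalStat [Fintype ι] [MeasurableSpace Ω]
    [MeasurableSpace Ω'] {P : Measure Ω} [IsProbabilityMeasure P]
    {P' : Measure Ω'} [IsProbabilityMeasure P'] {X ε : ι → ℕ → Ω → ℝ} {μ σ : ι → ℝ}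
    {σhat : ℕ → ι → Ω → ℝ} {W : ι → ℝ≥0 → Ω' → ℝ} {h : ℕ → ℕ} {β : ℝ} {ρ : ℝ → ℝ} {t : ℝ}
    (hε : ∀ i s, Measurable (ε i s)) (hσhat_meas : ∀ m i, Measurable (σhat m i))
    (hX : NullModel X μ ε) (hregime : AsymptoticRegime h β)
    (hW : ∀ i, IsBrownianReal (W i) P') (hW_indep : iIndepFun (fun i ω u => W i u ω) P')
    (hσ : ∀ i, 0 < σ i) (hFCLT : FCLT ε σ W P P')
    (hσhat : ∀ i, TendstoInMeasure P (fun m => σhat m i) atTop (fun _ => σ i))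
    (ht : 0 < t) (hρ : ContinuousAt ρ t) :
    TendstoInDistribution (fun (m : ℕ) ω => (ρ ((⌊h m * t⌋₊ : ℝ) / h m),
        scaledLocalStat X (σhat m) m ⌊h m * t⌋₊ (h m) ω)) atTop
      (fun ω => (ρ t, fun i => limitZ W β t i ω)) (fun _ => P) P' := by
  have hβ := hregime.pos
  have hβ0 : β.toNNReal ≠ 0 := (Real.toNNReal_pos.2 hβ).ne'
  have hV := TendstoInDistributionD.tendstoInDistribution_eval hFCLT
    (fun m i ω => isCadlag_scaledSum ε m i ω) (fun m i u => measurable_scaledSum hε m i u)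
    (fun i => (hW i).cont.mono fun ω hω => hω.const_mul (σ i))
    (fun i u => ((hW i).aemeasurable u).const_mul (σ i)) (hregime.tendsto_times ht)
  have hpar : Tendsto (fun m : ℕ => ((h m : ℝ) / m, √((m : ℝ) / h m),
      ρ ((⌊h m * t⌋₊ : ℝ) / h m))) atTop (𝓝 (β, (√β)⁻¹, ρ t)) :=
    hregime.ratio_tendsto.prodMk_nhds (hregime.tendsto_sqrt.prodMk_nhds
      (hρ.tendsto.comp (hregime.tendsto_floor_div_window ht)))
  have hVpar := hV.prodMk_of_tendstoInMeasure_const _ _ _ (tendstoInMeasure_of_tendsto_ae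
    (μ := P) (f := fun m _ => ((h m : ℝ) / m, √((m : ℝ) / h m), ρ ((⌊h m * t⌋₊ : ℝ) / h m)))
    (g := fun _ => (β, (√β)⁻¹, ρ t)) (fun m => aestronglyMeasurable_const)
    (Eventually.of_forall fun _ => hpar)) (fun m => aemeasurable_const)
  have hall := hVpar.prodMk_of_tendstoInMeasure_const _ (fun m ω i => σhat m i ω) _
    (c := σ) (tendstoInMeasure_pi hσhat)
    (fun m => aemeasurable_pi_lambda _ fun i => (hσhat_meas m i).aemeasurable)
  have hmap := tendstoInDistribution_comp_of_ae_continuousAt measurable_localMap hall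
    (Eventually.of_forall fun ω => continuousAt_localMap fun i => (hσ i).ne')
  have hev : ∀ᶠ m : ℕ in atTop, (fun ω => localMap (((fun p : ι × Fin 3 =>
      scaledSum ε m p.1 (times m ⌊h m * t⌋₊ (h m) p.2) ω), ((h m : ℝ) / m, √((m : ℝ) / h m),
      ρ ((⌊h m * t⌋₊ : ℝ) / h m))), fun i => σhat m i ω)) =
      fun ω => (ρ ((⌊h m * t⌋₊ : ℝ) / h m),
        scaledLocalStat X (σhat m) m ⌊h m * t⌋₊ (h m) ω) := by
    filter_upwards [hregime.eventually_window_le ht, eventually_ne_atTop 0] with m h1 h2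
    exact funext fun ω => scaledLocalStat_eq hX (σhat m) h2 h1 _ ω
  have hlocal := tendstoInDistribution_congr_of_eventually hmap (fun m =>
    (measurable_const.prodMk (measurable_pi_lambda _ fun i =>
      (measurable_localStat hX hε (hσhat_meas m) m _ _ i).const_mul _)).aemeasurable) hev
  refine tendstoInDistribution_of_identDistrib_limit hlocal ?_
  simp_rw [localMap_limit hσ W hβ]
  exact (identDistrib_contrast_scaled (fun i => (hW i).toIsPreBrownianReal) hW_indep β t hβ0).comp
    (u := fun v => (ρ t, fun i => |v i|))
    (measurable_const.prodMk (measurable_pi_lambda _ fun i => (measurable_pi_apply i).abs))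

end Limit

end Mosum

end

/-! ### The limits of the two global statistics -/

theorem mainTheorem1 {Ω Ω' : Type*} [MeasurableSpace Ω] [MeasurableSpace Ω']
    (P : Measure Ω) [IsProbabilityMeasure P] (P' : Measure Ω') [IsProbabilityMeasure P']
    (d : ℕ) (X ε : Fin d → ℕ → Ω → ℝ) (μ σ : Fin d → ℝ) (σhat : ℕ → Fin d → Ω → ℝ)
    (W : Fin d → ℝ≥0 → Ω' → ℝ) (h : ℕ → ℕ) (β : ℝ) (ρ : ℝ → ℝ) (c t : ℝ)
    (hε : ∀ i s, Measurable (ε i s))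
    (hσhat_meas : ∀ m i, Measurable (σhat m i))
    (hX : Mosum.NullModel X μ ε)
    (hregime : Mosum.AsymptoticRegime h β)
    (hW : ∀ i, IsBrownianReal (W i) P')
    (hW_indep : iIndepFun (fun i ω u => W i u ω) P')
    (hσ : ∀ i, 0 < σ i)
    (hFCLT : Mosum.FCLT ε σ W P P')
    (hσhat : ∀ i, TendstoInMeasure P (fun m => σhat m i) atTop (fun _ => σ i))
    (ht : 0 < t) (hρ : ContinuousAt ρ t) :
    TendstoInDistribution
      (fun (m : ℕ) ω => Mosum.weight ρ ⌊h m * t⌋₊ (h m) *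
        Mosum.centralizedStat X (σhat m) m ⌊h m * t⌋₊ (h m) ω)
      atTop (Mosum.centralizedLimit ρ W β t) (fun _ => P) P' ∧
    TendstoInDistribution
      (fun (m : ℕ) ω => Mosum.weight ρ ⌊h m * t⌋₊ (h m) *
        Mosum.distributedStat ρ c X (σhat m) m ⌊h m * t⌋₊ (h m) ω)
      atTop (Mosum.distributedLimit ρ c W β t) (fun _ => P) P' := by
  have key := Mosum.tendstoInDistribution_scaledLocalStat hε hσhat_meas hX hregime hW hW_indep hσ
    hFCLT hσhat ht hρ
  simp_rw [Mosum.weight_mul_centralizedStat, Mosum.weight_mul_distributedStat]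
  refine ⟨key.continuous_comp Mosum.continuous_aggregate,
    Mosum.tendstoInDistribution_comp_of_ae_continuousAt (Mosum.measurable_aggregateAbove c) key ?_⟩
  -- When `ρ t = 0` and `c = 0` the threshold is hit surely, so absence of atoms cannot help and
  -- this case is separate.
  rcases eq_or_ne (ρ t) 0 with h0 | h0
  · exact Eventually.of_forall fun ω => Mosum.continuousAt_aggregateAbove_of_fst_eq_zero c h0
  · have hne : ∀ z, ∀ᵐ ω ∂P', ∀ i, (Mosum.contrast β t fun u => W i u ω) ≠ z := fun z =>
      ae_all_iff.2 fun i => Mosum.ae_contrast_ne (hW i).toIsPreBrownianReal hregime.pos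
        hregime.le_one ht z
    -- Hitting the threshold means that the absolute contrast equals `c / ρ t`, so both signs must
    -- be excluded.
    filter_upwards [hne (c / ρ t), hne (-(c / ρ t))] with ω h1 h2
    refine Mosum.continuousAt_aggregateAbove_of_ne fun i hi => ?_
    have hz : |Mosum.contrast β t fun u => W i u ω| = c / ρ t := by
      rw [eq_div_iff h0, mul_comm]
      exact hi
    rcases abs_choice (Mosum.contrast β t fun u => W i u ω) with h3 | h3
    · exact h1 i (h3 ▸ hz)
    · exact h2 i (by rw [← hz, h3, neg_neg])
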